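/- Consider a periodic chain of $n$ spins of fixed local dimension $d$, with Hilbert space $(\mathbb C^d)^{\otimes n}$, and let $\mathbb T$ be the unitary translation operator, $\mathbb T|x_1,\dots,x_n\rangle=|x_n,x_1,\dots,x_{n-1}\rangle$. Let $H$ be a Hermitian operator that is translation-invariant ($\mathbb TH=H\mathbb T$) and has non-degenerate spectrum (all $d^n$ eigenvalues are distinct). Let $A$ be a (not necessarily Hermitian) operator with $\operatorname{tr}A=0$ and operator norm $\|A\|\le M$, supported in a consecutive region of $k$ sites. For a product state $|\psi\rangle=\bigotimes_{l=1}^n|\psi_l\rangle$ of unit vectors put $$A^\infty_\psi:=\lim_{\tau\to\infty}\frac1\tau\int_0^\tau\langle\psi|e^{iHt}Ae^{-iHt}|\psi\rangle\,\mathrm dt .$$ This limit exists for every product state. Let $|\psi\rangle$ be random, the $|\psi_l\rangle$ being independent and Haar-distributed (uniform on the unit sphere of $\mathbb C^d$). Then there are positive constants $K,C,c$ and an integer $n_0$, depending only on $d$, $k$ and $M$, such that for all $n\ge n_0$ and all such $H$ and $A$, $$\mathbb E_\psi|A^\infty_\psi|\le\frac{K}{\sqrt n},$$ and, for every $\delta\ge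 C\sqrt{(\log n)/n}$, $$\Pr_\psi\bigl(|A^\infty_\psi|\ge\delta\bigr)\le e^{-c\,n\delta^2}.$$ -/

import Mathlib

open Filter Topology MeasureTheory

noncomputable section

namespace SpinChain

/-- Computational basis states `|x₁,…,xₙ⟩` of a chain of `n` spins of local dimension `d`. -/
abbrev Config (d n : ℕ) : Type := Fin n → Fin d

/-- Linear operators on the Hilbert space `(ℂ^d)^{⊗ n}`, of dimension `d ^ n`, written as matrices
in the computational basis. -/
abbrev Op (d n : ℕ) : Type := Matrix (Config d n) (Config d n) ℂ

/-- The lattice translation operator (periodic boundary conditions),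
`T |x₁,…,xₙ⟩ = |xₙ,x₁,…,xₙ₋₁⟩`: the content of site `l` is moved to site `l + 1` modulo `n`. -/
def translation (d n : ℕ) : Op d n :=
  Matrix.of fun y x => if y = (fun l => x ((finRotate n).symm l)) then 1 else 0

/-- `H` is translation-invariant: it commutes with the lattice translation operator. -/
def IsTranslationInvariant {d n : ℕ} (H : Op d n) : Prop :=
  translation d n * H = H * translation d n

/-- The spectrum of a Hermitian operator is non-degenerate: its eigenvalues, listed with
multiplicity, are pairwise distinct. -/
def HasNondegenerateSpectrum {d n : ℕ} {H : Op d n} (hH : H.IsHermitian) : Prop :=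
  Function.Injective hH.eigenvalues

/-- `A` is supported on the set of sites `S`, i.e. `A = B ⊗ 1` with `B` acting on the sites in `S`
and the identity on all other sites. -/
def IsSupportedOn {d n : ℕ} (A : Op d n) (S : Finset (Fin n)) : Prop :=
  ∃ B : Matrix (S → Fin d) (S → Fin d) ℂ, ∀ x y : Config d n,
    A x y = if ∀ i, i ∉ S → x i = y i then B (fun i => x i) (fun i => y i) else 0

/-- The consecutive region `{l, l + 1, …, l + k - 1}` of the periodic chain (subtraction in `Fin n`
is subtraction modulo `n`). -/
def region {n : ℕ} (l : Fin n) (k : ℕ) : Finset (Fin n) :=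
  Finset.univ.filter fun i => ((i - l : Fin n) : ℕ) < k

/-- `A` is `k`-local: its support is contained in a consecutive region of size `k`. -/
def IsLocal {d n : ℕ} (k : ℕ) (A : Op d n) : Prop :=
  ∃ l : Fin n, IsSupportedOn A (region l k)

/-- The operator norm of `A` with respect to the Hilbert space norm. -/
def opNorm {d n : ℕ} (A : Op d n) : ℝ :=
  ‖Matrix.toEuclideanCLM (n := Config d n) (𝕜 := ℂ) A‖

/-- Heisenberg evolution `A(t) = e^{iHt} A e^{-iHt}`. -/
def heisenberg {d n : ℕ} (H A : Op d n) (t : ℝ) : Op d n :=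
  NormedSpace.exp ((Complex.I * (t : ℂ)) • H) * A * NormedSpace.exp ((-(Complex.I * (t : ℂ))) • H)

/-- Normalized state vectors of one spin: the unit sphere of `ℂ^d`. -/
abbrev SpinState (d : ℕ) : Type := Metric.sphere (0 : EuclideanSpace ℂ (Fin d)) 1

/-- The Haar measure on normalized state vectors of one spin: the surface measure on the unit sphere
of `ℂ^d`, normalized to total mass one. -/
def haarState (d : ℕ) : Measure (SpinState d) :=
  ((volume : Measure (EuclideanSpace ℂ (Fin d))).toSphere Set.univ)⁻¹ •
    (volume : Measure (EuclideanSpace ℂ (Fin d))).toSphere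

/-- The distribution of a random product state: the `n` one-spin states are independent and Haar
distributed. -/
def randomProductState (d n : ℕ) : Measure (Fin n → SpinState d) :=
  Measure.pi fun _ => haarState d

/-- The vector `|ψ⟩ = ⨂ₗ |ψₗ⟩` in the computational basis. -/
def productVec {d n : ℕ} (ψ : Fin n → SpinState d) : Config d n → ℂ :=
  fun x => ∏ l, (ψ l : EuclideanSpace ℂ (Fin d)) (x l)

/-- The expectation value `⟨ψ|A|ψ⟩` in the product state `|ψ⟩`. -/
def expVal {d n : ℕ} (A : Op d n) (ψ : Fin n → SpinState d) : ℂ :=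
  star (productVec ψ) ⬝ᵥ (A.mulVec (productVec ψ))

/-- The average of `⟨ψ|A(t)|ψ⟩` over times `0 ≤ t ≤ τ`. -/
def finiteTimeAverage {d n : ℕ} (H A : Op d n) (ψ : Fin n → SpinState d) (τ : ℝ) : ℂ :=
  (1 / (τ : ℂ)) * ∫ t in (0 : ℝ)..τ, expVal (heisenberg H A t) ψ

/-- The time-averaged expectation value `A^∞_ψ`: the limit of the averages over `[0, τ]` as
`τ → ∞`. -/
def timeAverage {d n : ℕ} (H A : Op d n) (ψ : Fin n → SpinState d) : ℂ :=
  limUnder atTop (finiteTimeAverage H A ψ)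

end SpinChain

end

namespace SpinChain

/-! Since the spectrum is simple, time averaging removes every off-diagonal term in the eigenbasis
of `H`, leaving `A^∞_ψ = ∑ⱼ |⟨j|ψ⟩|² Aⱼⱼ` (`timeAverage_eq`). It is a convex combination of the
diagonal entries `Aⱼⱼ`, and each weight has mean `d⁻ⁿ`, because a random product state has the
maximally mixed state as its average.

The entries `Aⱼⱼ` are mostly small. Eigenvectors of `H` are also eigenvectors of the translation, so
`Aⱼⱼ` does not change when `A` is translated. It is therefore `1/m` times the diagonal entry of a
sum `B` of `m = ⌊n/(k+1)⌋` translates with disjoint supports. For Hermitian `A`, Peierls' inequality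
bounds `∑ⱼ exp(r Aⱼⱼ)` by `tr exp(rB/m)`. This trace factorizes over the translates
(`trace_exp_spacedSum`), and Hoeffding's lemma for the centred spectrum of `A` bounds it by `dⁿ
exp(r²M²/(2m))`.

Jensen's inequality in the weights `|⟨j|ψ⟩|²`, followed by the mean over `ψ`, transfers this bound
to `A^∞_ψ` (`integral_exp_timeAverage_le`). A general `A` is reduced to the Hermitian case through
the Hermitian parts of `uA` with `|u| = 1`. So `A^∞_ψ` is subgaussian with variance proxy of order
`1/n`, which gives both the mean and the tail bound. -/

/-! ### Haar-random product states and their second moments -/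

/-- The restriction of a linear isometry to the unit sphere. -/
def sphereIsometry {E : Type*} [NormedAddCommGroup E] [NormedSpace ℝ E] (e : E ≃ₗᵢ[ℝ] E) :
    Metric.sphere (0 : E) 1 → Metric.sphere (0 : E) 1 :=
  fun v => ⟨e v, by simp⟩

-- The surface measure of `s` is a constant times the volume of the cone `(0,1) • s`, and a linear
-- isometry maps cones to cones.
open scoped Pointwise in
theorem measurePreserving_sphereIsometry {E : Type*} [NormedAddCommGroup E] [NormedSpace ℝ E]
    [MeasurableSpace E] [BorelSpace E] (μ : Measure E) (e : E ≃ₗᵢ[ℝ] E)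
    (he : MeasurePreserving e μ μ) :
    MeasurePreserving (sphereIsometry e) μ.toSphere μ.toSphere := by
  have hm : Measurable (sphereIsometry e) :=
    (e.continuous.comp continuous_subtype_val).measurable.subtype_mk
  refine ⟨hm, Measure.ext fun s hs => ?_⟩
  rw [Measure.map_apply hm hs, Measure.toSphere_apply' _ hs, Measure.toSphere_apply' _ (hm hs)]
  congr 1
  have h : Set.Ioo (0 : ℝ) 1 • ((↑) '' (sphereIsometry e ⁻¹' s) : Set E) =
      e ⁻¹' (Set.Ioo (0 : ℝ) 1 • ((↑) '' s : Set E)) := by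
    ext v
    simp only [Set.mem_preimage, Set.mem_smul, Set.mem_image]
    constructor
    · rintro ⟨r, hr, w, ⟨u, hu, rfl⟩, rfl⟩
      exact ⟨r, hr, e u, ⟨sphereIsometry e u, hu, rfl⟩, by simp⟩
    · rintro ⟨r, hr, w, ⟨u, hu, rfl⟩, h⟩
      refine ⟨r, hr, e.symm u, ⟨⟨e.symm u, by simp⟩, ?_, rfl⟩, ?_⟩
      · simpa [sphereIsometry] using hu
      · apply e.injective
        simpa using h
  rw [h, he.measure_preimage_emb e.toHomeomorph.measurableEmbedding]

theorem measurePreserving_haarState {d : ℕ}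
    (e : EuclideanSpace ℂ (Fin d) ≃ₗᵢ[ℝ] EuclideanSpace ℂ (Fin d)) :
    MeasurePreserving (sphereIsometry e) (haarState d) (haarState d) := by
  have h := measurePreserving_sphereIsometry volume e e.measurePreserving
  refine ⟨h.measurable, ?_⟩
  rw [haarState, Measure.map_smul, h.map_eq]

theorem isProbabilityMeasure_haarState {d : ℕ} (hd : 1 ≤ d) :
    IsProbabilityMeasure (haarState d) := by
  have : Nonempty (Fin d) := ⟨⟨0, hd⟩⟩
  constructor
  rw [haarState, Measure.smul_apply, smul_eq_mul]
  refine ENNReal.inv_mul_cancel ?_ (measure_ne_top _ _)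
  rw [Ne, Measure.measure_univ_eq_zero]
  exact Measure.toSphere_ne_zero _

theorem integral_haarState_comp {d : ℕ}
    (e : EuclideanSpace ℂ (Fin d) ≃ₗᵢ[ℝ] EuclideanSpace ℂ (Fin d)) (f : SpinState d → ℂ)
    (hf : Continuous f) :
    ∫ v, f (sphereIsometry e v) ∂haarState d = ∫ v, f v ∂haarState d := by
  have h := measurePreserving_haarState e
  conv_rhs => rw [← h.map_eq]
  rw [integral_map h.measurable.aemeasurable hf.aestronglyMeasurable]

theorem continuous_spinState_apply {d : ℕ} (a : Fin d) :
    Continuous fun v : SpinState d => (v : EuclideanSpace ℂ (Fin d)) a := by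
  fun_prop

/-- Finitely many symmetries of the sphere suffice. Swapping coordinates makes all diagonal moments
equal, and they sum to one by normalization. Flipping the sign of the coordinate `a` negates the
off-diagonal moments. -/
theorem integral_haarState_star_mul {d : ℕ} (hd : 1 ≤ d) (a b : Fin d) :
    ∫ v, star ((v : EuclideanSpace ℂ (Fin d)) a) * (v : EuclideanSpace ℂ (Fin d)) b ∂haarState d =
      if a = b then 1 / (d : ℂ) else 0 := by
  have := isProbabilityMeasure_haarState hd
  have hc : ∀ a b : Fin d, Continuous fun v : SpinState d =>
      star ((v : EuclideanSpace ℂ (Fin d)) a) * (v : EuclideanSpace ℂ (Fin d)) b :=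
    fun a b => (continuous_spinState_apply a).star.mul (continuous_spinState_apply b)
  split_ifs with hab
  · subst hab
    have hsymm : ∀ b : Fin d,
        ∫ v, star ((v : EuclideanSpace ℂ (Fin d)) b) * (v : EuclideanSpace ℂ (Fin d)) b
          ∂haarState d =
        ∫ v, star ((v : EuclideanSpace ℂ (Fin d)) a) * (v : EuclideanSpace ℂ (Fin d)) a
          ∂haarState d := by
      intro b
      rw [← integral_haarState_comp
        (LinearIsometryEquiv.piLpCongrLeft 2 ℝ ℂ (Equiv.swap a b)) _ (hc b b)]
      simp [sphereIsometry]
    have hsum : ∑ b : Fin d,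
        ∫ v, star ((v : EuclideanSpace ℂ (Fin d)) b) * (v : EuclideanSpace ℂ (Fin d)) b
          ∂haarState d = 1 := by
      rw [← integral_finsetSum _ fun b _ =>
        (hc b b).integrable_of_hasCompactSupport (HasCompactSupport.of_compactSpace _)]
      have : ∀ v : SpinState d, ∑ b : Fin d,
          star ((v : EuclideanSpace ℂ (Fin d)) b) * (v : EuclideanSpace ℂ (Fin d)) b = 1 := by
        intro v
        have h1 : ‖(v : EuclideanSpace ℂ (Fin d))‖ ^ 2 = 1 := by simp
        rw [EuclideanSpace.norm_sq_eq] at h1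
        have h2 : ((∑ i, ‖(v : EuclideanSpace ℂ (Fin d)) i‖ ^ 2 : ℝ) : ℂ) = 1 := by
          rw [h1]; simp
        rw [← h2]
        push_cast
        exact Finset.sum_congr rfl fun b _ => by
          rw [← Complex.conj_mul']; rfl
      simp only [this, integral_const, probReal_univ, one_smul]
    simp only [hsymm, Finset.sum_const, Finset.card_univ, Fintype.card_fin, nsmul_eq_mul] at hsum
    have : (d : ℂ) ≠ 0 := by exact_mod_cast (by omega : d ≠ 0)
    field_simp
    rw [mul_comm]; exact hsum
  · have h := integral_haarState_comp
      (LinearIsometryEquiv.piLpCongrRight 2 fun i : Fin d =>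
        if i = a then LinearIsometryEquiv.neg ℝ else LinearIsometryEquiv.refl ℝ ℂ) _ (hc a b)
    have hba : b ≠ a := fun h => hab h.symm
    simp only [sphereIsometry, LinearIsometryEquiv.piLpCongrRight_apply, if_pos, if_neg hba,
      LinearIsometryEquiv.coe_neg, LinearIsometryEquiv.coe_refl, id, star_neg, neg_mul,
      integral_neg] at h
    exact self_eq_neg.mp h.symm

theorem isProbabilityMeasure_randomProductState {d : ℕ} (hd : 1 ≤ d) (n : ℕ) :
    IsProbabilityMeasure (randomProductState d n) := by
  have := isProbabilityMeasure_haarState hd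
  unfold randomProductState
  infer_instance

theorem continuous_productVec {d n : ℕ} (x : Config d n) :
    Continuous fun ψ : Fin n → SpinState d => productVec ψ x :=
  continuous_finsetProd _ fun l _ =>
    (continuous_spinState_apply (x l)).comp (continuous_apply l)

theorem integral_productVec {d : ℕ} (hd : 1 ≤ d) {n : ℕ} (x y : Config d n) :
    ∫ ψ, star (productVec ψ x) * productVec ψ y ∂randomProductState d n =
      if x = y then 1 / (d : ℂ) ^ n else 0 := by
  have := isProbabilityMeasure_haarState hd
  have h : ∀ ψ : Fin n → SpinState d, star (productVec ψ x) * productVec ψ y =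
      ∏ l, (star ((ψ l : EuclideanSpace ℂ (Fin d)) (x l)) *
        (ψ l : EuclideanSpace ℂ (Fin d)) (y l)) := by
    intro ψ
    simp only [productVec, star_prod, Finset.prod_mul_distrib]
  simp only [h, randomProductState]
  rw [integral_fintype_prod_eq_prod (fun l (v : SpinState d) =>
    star ((v : EuclideanSpace ℂ (Fin d)) (x l)) * (v : EuclideanSpace ℂ (Fin d)) (y l))]
  simp only [integral_haarState_star_mul hd]
  split_ifs with hxy
  · subst hxy; simp
  · obtain ⟨l, hl⟩ := Function.ne_iff.mp hxy
    exact Finset.prod_eq_zero (Finset.mem_univ l) (if_neg hl)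

theorem integrable_randomProductState {d : ℕ} (hd : 1 ≤ d) {n : ℕ} {F : Type*}
    [NormedAddCommGroup F] {f : (Fin n → SpinState d) → F} (hf : Continuous f) :
    Integrable f (randomProductState d n) := by
  have := isProbabilityMeasure_randomProductState hd n
  exact hf.integrable_of_hasCompactSupport (HasCompactSupport.of_compactSpace _)

theorem norm_productVec {d n : ℕ} (ψ : Fin n → SpinState d) :
    ∑ x, ‖productVec ψ x‖ ^ 2 = 1 := by
  have h : ∀ x, ‖productVec ψ x‖ ^ 2 = ∏ l, ‖(ψ l : EuclideanSpace ℂ (Fin d)) (x l)‖ ^ 2 := by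
    intro x
    rw [productVec, norm_prod, Finset.prod_pow]
  simp only [h]
  rw [← Fintype.prod_sum (fun l a => ‖(ψ l : EuclideanSpace ℂ (Fin d)) a‖ ^ 2)]
  refine Finset.prod_eq_one fun l _ => ?_
  rw [← EuclideanSpace.norm_sq_eq]
  simp

/-- The mean overlap of a random product state with a fixed vector. -/
theorem integral_overlap {d : ℕ} (hd : 1 ≤ d) {n : ℕ} (φ : Config d n → ℂ) :
    ∫ ψ, ‖∑ x, φ x * productVec ψ x‖ ^ 2 ∂randomProductState d n =
      (∑ x, ‖φ x‖ ^ 2) / (d : ℝ) ^ n := by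
  have h : ∀ ψ : Fin n → SpinState d, ((‖∑ x, φ x * productVec ψ x‖ ^ 2 : ℝ) : ℂ) =
      ∑ x, ∑ y, star (φ x) * φ y * (star (productVec ψ x) * productVec ψ y) := by
    intro ψ
    push_cast
    rw [← Complex.conj_mul', map_sum, Finset.sum_mul_sum]
    refine Finset.sum_congr rfl fun x _ => Finset.sum_congr rfl fun y _ => ?_
    rw [map_mul]
    simp only [Complex.star_def]
    ring
  have hc : ∀ x y : Config d n, Continuous fun ψ : Fin n → SpinState d =>
      star (φ x) * φ y * (star (productVec ψ x) * productVec ψ y) := fun x y =>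
    continuous_const.mul ((continuous_productVec x).star.mul (continuous_productVec y))
  rw [← Complex.ofReal_inj, ← integral_complex_ofReal]
  simp only [h]
  rw [integral_finsetSum _ fun x _ => integrable_finsetSum _ fun y _ =>
    integrable_randomProductState hd (hc x y)]
  simp only [integral_finsetSum _ fun y _ => integrable_randomProductState hd (hc _ y),
    integral_const_mul, integral_productVec hd, mul_ite, mul_zero, Finset.sum_ite_eq,
    Finset.mem_univ, if_true]
  push_cast
  rw [Finset.sum_div]
  refine Finset.sum_congr rfl fun x _ => ?_
  rw [← Complex.conj_mul', Complex.star_def]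
  ring

/-! ### Operators acting on a set of sites -/

/-- Apply the permutation `π i` to the content of every site `i`. -/
def sitePerm {d n : ℕ} (π : Fin n → Equiv.Perm (Fin d)) : Equiv.Perm (Config d n) :=
  Equiv.piCongrRight π

/-- An operator acts trivially outside `S`: it commutes with the diagonal operators and with the
permutation operators of the sites outside `S`. -/
def ActsOn {d n : ℕ} (A : Op d n) (S : Finset (Fin n)) : Prop :=
  (∀ i ∉ S, ∀ a : Fin d, Commute (Matrix.diagonal fun x : Config d n => if x i = a then 1 else 0) A) ∧
  ∀ π : Fin n → Equiv.Perm (Fin d), (∀ i ∈ S, π i = 1) →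
    Commute ((sitePerm π).toPEquiv.toMatrix : Op d n) A

namespace ActsOn

variable {d n : ℕ} {A B : Op d n} {S S' : Finset (Fin n)}

theorem mono (h : ActsOn A S) (hS : S ⊆ S') : ActsOn A S' :=
  ⟨fun i hi => h.1 i fun hi' => hi (hS hi'), fun π hπ => h.2 π fun i hi => hπ i (hS hi)⟩

theorem zero : ActsOn (0 : Op d n) S :=
  ⟨fun _ _ _ => Commute.zero_right _, fun _ _ => Commute.zero_right _⟩

theorem add (hA : ActsOn A S) (hB : ActsOn B S) : ActsOn (A + B) S :=
  ⟨fun i hi a => (hA.1 i hi a).add_right (hB.1 i hi a),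
    fun π hπ => (hA.2 π hπ).add_right (hB.2 π hπ)⟩

theorem smul (c : ℂ) (hA : ActsOn A S) : ActsOn (c • A) S :=
  ⟨fun i hi a => (hA.1 i hi a).smul_right c, fun π hπ => (hA.2 π hπ).smul_right c⟩

/-- This is the gain from describing support by commutation: a commutant is closed under the
exponential, so no tensor factor has to be exhibited. -/
theorem exp (hA : ActsOn A S) : ActsOn (NormedSpace.exp A) S :=
  ⟨fun i hi a => (hA.1 i hi a).exp_right, fun π hπ => (hA.2 π hπ).exp_right⟩

theorem apply_eq_zero (hA : ActsOn A S) {x y : Config d n} {i : Fin n} (hi : i ∉ S)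
    (hxy : x i ≠ y i) : A x y = 0 := by
  have h := congrFun (congrFun (hA.1 i hi (x i)).eq x) y
  rw [Matrix.diagonal_mul, Matrix.mul_diagonal] at h
  simpa [hxy.symm] using h

theorem apply_sitePerm (hA : ActsOn A S) {π : Fin n → Equiv.Perm (Fin d)}
    (hπ : ∀ i ∈ S, π i = 1) (x y : Config d n) : A (sitePerm π x) (sitePerm π y) = A x y := by
  have h := congrFun (congrFun (hA.2 π hπ).eq x) (sitePerm π y)
  rw [PEquiv.toMatrix_toPEquiv_mul, PEquiv.mul_toMatrix_toPEquiv] at h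
  simpa using h

theorem diag_congr (hA : ActsOn A S) {x y : Config d n} (h : ∀ i ∈ S, x i = y i) :
    A x x = A y y := by
  rw [← hA.apply_sitePerm (π := fun i => Equiv.swap (x i) (y i)) (fun i hi => by
    rw [h i hi]; exact Equiv.swap_self _) x x]
  have : sitePerm (fun i => Equiv.swap (x i) (y i)) x = y := by
    funext i
    simp [sitePerm]
  rw [this]

/-- In the `(x, y)` entry of `A * B` only one intermediate configuration survives: `A` forces it to
agree with `x` off `S`, and `B` forces it to agree with `y` on `S`. For `B * A` the roles of `x` and
`y` are exchanged. Swapping `x i` and `y i` at sites where an operator acts trivially identifies the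
two products. -/
theorem commute (hA : ActsOn A S) (hB : ActsOn B S') (hS : Disjoint S S') : Commute A B := by
  have hS1 : ∀ i ∈ S, i ∉ S' := fun i hi hi' => Finset.disjoint_left.mp hS hi hi'
  ext x y
  rw [Matrix.mul_apply, Matrix.mul_apply,
    Finset.sum_eq_single (S.piecewise y x), Finset.sum_eq_single (S.piecewise x y)]
  · rw [mul_comm (B x _)]
    congr 1
    · rw [← hA.apply_sitePerm
        (π := fun i => if i ∈ S then 1 else Equiv.swap (x i) (y i)) (fun i hi => by simp [hi])]
      congr 1 <;> funext i <;> by_cases hi : i ∈ S <;> simp [sitePerm, hi]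
    · rw [← hB.apply_sitePerm
        (π := fun i => if i ∈ S then Equiv.swap (x i) (y i) else 1)
        (fun i hi => if_neg fun h => hS1 i h hi)]
      congr 1 <;> funext i <;> by_cases hi : i ∈ S <;> simp [sitePerm, hi]
  · intro z _ hz
    obtain ⟨i, hi⟩ := Function.ne_iff.mp hz
    by_cases his : i ∈ S
    · rw [hB.apply_eq_zero (hS1 i his), zero_mul]
      simpa [his, eq_comm] using hi
    · rw [hA.apply_eq_zero his, mul_zero]
      simpa [his] using hi
  · simp
  · intro z _ hz
    obtain ⟨i, hi⟩ := Function.ne_iff.mp hz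
    by_cases his : i ∈ S
    · rw [hB.apply_eq_zero (hS1 i his), mul_zero]
      simpa [his] using hi
    · rw [hA.apply_eq_zero his, zero_mul]
      simpa [his, eq_comm] using hi
  · simp

/-- The trace of a product of operators with disjoint supports factorizes. -/
theorem trace_mul (hA : ActsOn A S) (hB : ActsOn B S') (hS : Disjoint S S') :
    (d : ℂ) ^ n * (A * B).trace = A.trace * B.trace := by
  have hS1 : ∀ i ∈ S, i ∉ S' := fun i hi hi' => Finset.disjoint_left.mp hS hi hi'
  have hdiag : ∀ x, (A * B) x x = A x x * B x x := by
    intro x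
    rw [Matrix.mul_apply, Finset.sum_eq_single x _ (by simp)]
    intro z _ hz
    obtain ⟨i, hi⟩ := Function.ne_iff.mp hz
    by_cases his : i ∈ S
    · rw [hB.apply_eq_zero (hS1 i his) hi, mul_zero]
    · rw [hA.apply_eq_zero his hi.symm, zero_mul]
  -- This involution exchanges the contents of two configurations off `S`. It leaves the `A`-factor
  -- unchanged and moves the `B`-factor from the first configuration to the second, which decouples
  -- the double sum.
  let e : Equiv.Perm (Config d n × Config d n) :=
    { toFun := fun p => (S.piecewise p.1 p.2, S.piecewise p.2 p.1)
      invFun := fun p => (S.piecewise p.1 p.2, S.piecewise p.2 p.1)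
      left_inv := fun p => by
        ext i <;> by_cases hi : i ∈ S <;> simp [hi]
      right_inv := fun p => by
        ext i <;> by_cases hi : i ∈ S <;> simp [hi] }
  have h1 : A.trace * B.trace = ∑ p : Config d n × Config d n, A p.1 p.1 * B p.2 p.2 := by
    rw [Matrix.trace, Matrix.trace, Finset.sum_mul_sum, Fintype.sum_prod_type]
    rfl
  have h2 : (d : ℂ) ^ n * (A * B).trace =
      ∑ p : Config d n × Config d n, A p.1 p.1 * B p.1 p.1 := by
    rw [Fintype.sum_prod_type_right]
    simp [Matrix.trace, hdiag]
  rw [h1, h2, ← Equiv.sum_comp e]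
  refine Finset.sum_congr rfl fun p _ => ?_
  rw [hA.diag_congr (y := p.1) (fun i hi => by simp [e, hi]),
    hB.diag_congr (y := p.2) 
    (fun i hi => Finset.piecewise_eq_of_notMem _ _ _ fun h => hS1 i h hi)]

end ActsOn

theorem IsSupportedOn.actsOn {d n : ℕ} {A : Op d n} {S : Finset (Fin n)}
    (h : IsSupportedOn A S) : ActsOn A S := by
  obtain ⟨B, hB⟩ := h
  constructor
  · intro i hi a
    ext x y
    rw [Matrix.diagonal_mul, Matrix.mul_diagonal, hB]
    split_ifs with h1 h2 h3 h3 <;> simp_all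
  · intro π hπ
    ext x y
    rw [PEquiv.toMatrix_toPEquiv_mul, PEquiv.mul_toMatrix_toPEquiv, Matrix.submatrix_apply,
      Matrix.submatrix_apply]
    obtain ⟨y, rfl⟩ := (sitePerm π).surjective y
    rw [id, id, Equiv.symm_apply_apply, hB, hB]
    have h1 : (∀ i, i ∉ S → sitePerm π x i = sitePerm π y i) ↔ ∀ i, i ∉ S → x i = y i := by
      simp [sitePerm]
    have h2 : ∀ z : Config d n, (fun i : S => sitePerm π z i) = fun i : S => z i := by
      intro z
      funext i
      simp [sitePerm, hπ i i.2]
    simp only [h1, h2]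

/-! ### Translates with disjoint supports -/

/-- The translate of an operator by `c` sites. -/
def translateOp {d n : ℕ} [NeZero n] (c : Fin n) (A : Op d n) : Op d n :=
  A.submatrix (fun x i => x (i + c)) (fun x i => x (i + c))

theorem isSupportedOn_translateOp {d n : ℕ} [NeZero n] {A : Op d n} {S : Finset (Fin n)}
    (h : IsSupportedOn A S) (c : Fin n) :
    IsSupportedOn (translateOp c A) (Finset.univ.filter fun i => i - c ∈ S) := by
  obtain ⟨B, hB⟩ := h
  refine ⟨B.submatrix (fun x i => x ⟨i + c, by simp⟩) (fun x i => x ⟨i + c, by simp⟩), ?_⟩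
  intro x y
  rw [translateOp, Matrix.submatrix_apply, hB]
  have h1 : (∀ i, i ∉ S → x (i + c) = y (i + c)) ↔
      ∀ i, i ∉ Finset.univ.filter (fun i => i - c ∈ S) → x i = y i := by
    constructor
    · intro h i hi
      have := h (i - c) (by simpa using hi)
      simpa using this
    · intro h i hi
      exact h _ (by simpa using hi)
  simp only [h1]
  rfl

/-- The blocks `0, …, n/(k+1) - 1` fit on the ring without wrapping around: the offset between two
of them plus a position below `k` stays below `n`, so no reduction modulo `n` occurs. Spacing `k +
1` instead of `k` keeps the division meaningful for `k = 0`. -/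
theorem disjoint_translate_region {n k : ℕ} [NeZero n] (l : Fin n) {s t : ℕ} (hst : s < t)
    (ht : t < n / (k + 1)) :
    Disjoint (Finset.univ.filter fun i : Fin n => i - Fin.ofNat n (s * (k + 1)) ∈ region l k)
      (Finset.univ.filter fun i : Fin n => i - Fin.ofNat n (t * (k + 1)) ∈ region l k) := by
  rw [Finset.disjoint_left]
  intro i hi hj
  simp only [region, Finset.mem_filter, Finset.mem_univ, true_and] at hi hj
  have hle : (t + 1) * (k + 1) ≤ n :=
    (Nat.mul_le_mul_right _ ht).trans (Nat.div_mul_le_self n (k + 1))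
  obtain ⟨r, rfl⟩ := Nat.exists_eq_add_of_lt hst
  have hadd : i - Fin.ofNat n (s * (k + 1)) - l =
      (i - Fin.ofNat n ((s + r + 1) * (k + 1)) - l) + Fin.ofNat n ((r + 1) * (k + 1)) := by
    have : Fin.ofNat n ((s + r + 1) * (k + 1)) =
        Fin.ofNat n (s * (k + 1)) + Fin.ofNat n ((r + 1) * (k + 1)) := by
      rw [Fin.ofNat_add, Fin.ext_iff]
      simp only [Fin.ofNat, Nat.add_mod_mod]
      congr 1
      ring
    rw [this]
    obtain ⟨m, rfl⟩ := Nat.exists_eq_succ_of_ne_zero (NeZero.ne n)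
    abel
  rw [hadd, Fin.val_add] at hi
  set a := ((i - Fin.ofNat n ((s + r + 1) * (k + 1)) - l : Fin n) : ℕ)
  have h2 : (r + 1) * (k + 1) + (s + 1) * (k + 1) = (s + r + 1 + 1) * (k + 1) := by ring
  have h3 : (s + 1) * (k + 1) ≥ k + 1 := by nlinarith
  have h4 : (r + 1) * (k + 1) ≥ k + 1 := by nlinarith
  have h5 : ((Fin.ofNat n ((r + 1) * (k + 1)) : Fin n) : ℕ) = (r + 1) * (k + 1) :=
    Nat.mod_eq_of_lt (by omega)
  rw [h5, Nat.mod_eq_of_lt (by omega)] at hi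
  omega

/-! ### Hoeffding's lemma, matrix exponentials and Peierls' inequality -/

/-- **Hoeffding's lemma** for a centred finite family. -/
theorem sum_exp_mul_le {ι : Type*} [Fintype ι] {M : ℝ} (hM : 0 < M) {b : ι → ℝ} (hb : ∀ i, |b i| ≤ M)
    (hsum : ∑ i, b i = 0) (t : ℝ) :
    ∑ i, Real.exp (t * b i) ≤ Fintype.card ι * Real.exp (t ^ 2 * M ^ 2 / 2) := by
  -- Convexity puts `exp` below its chord over `[-tM, tM]`. The linear part of the chord vanishes
  -- after summation because the family is centred.
  have h1 : ∀ i, Real.exp (t * b i) ≤ Real.cosh (t * M) + b i * (Real.sinh (t * M) / M) := by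
    intro i
    obtain ⟨h2, h3⟩ := abs_le.mp (hb i)
    have h4 : -1 ≤ b i / M := by rw [le_div_iff₀ hM]; linarith
    have h5 : b i / M ≤ 1 := by rw [div_le_iff₀ hM]; linarith
    have h := convexOn_exp.2 (Set.mem_univ (t * M)) (Set.mem_univ (-(t * M)))
      (by linarith : 0 ≤ (1 + b i / M) / 2) (by linarith : 0 ≤ (1 - b i / M) / 2) (by ring)
    simp only [smul_eq_mul] at h
    have h6 : (1 + b i / M) / 2 * (t * M) + (1 - b i / M) / 2 * -(t * M) = t * b i := by
      field_simp
      ring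
    rw [h6] at h
    refine h.trans (le_of_eq ?_)
    rw [Real.cosh_eq, Real.sinh_eq]
    ring
  calc ∑ i, Real.exp (t * b i) ≤ ∑ i, (Real.cosh (t * M) + b i * (Real.sinh (t * M) / M)) :=
        Finset.sum_le_sum fun i _ => h1 i
    _ = Fintype.card ι * Real.cosh (t * M) := by
        rw [Finset.sum_add_distrib, ← Finset.sum_mul, hsum]
        simp
    _ ≤ Fintype.card ι * Real.exp (t ^ 2 * M ^ 2 / 2) := by
        have h := Real.cosh_le_exp_half_sq (t * M)
        rw [mul_pow] at h
        gcongr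

section Spectral

variable {ι : Type*} [Fintype ι] [DecidableEq ι]

theorem eq_conj_diagonal_eigenvalues {B : Matrix ι ι ℂ} (hB : B.IsHermitian) :
    B = (hB.eigenvectorUnitary : Matrix ι ι ℂ) *
      Matrix.diagonal (fun i => (hB.eigenvalues i : ℂ)) *
      star (hB.eigenvectorUnitary : Matrix ι ι ℂ) := by
  conv_lhs => rw [hB.spectral_theorem]
  rfl

theorem exp_smul_eq_conj_diagonal {B : Matrix ι ι ℂ} (hB : B.IsHermitian) (c : ℂ) :
    NormedSpace.exp (c • B) = (hB.eigenvectorUnitary : Matrix ι ι ℂ) *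
      Matrix.diagonal (fun i => Complex.exp (c * hB.eigenvalues i)) *
      star (hB.eigenvectorUnitary : Matrix ι ι ℂ) := by
  have hV : (hB.eigenvectorUnitary : Matrix ι ι ℂ)⁻¹ =
      star (hB.eigenvectorUnitary : Matrix ι ι ℂ) :=
    Matrix.inv_eq_left_inv (Unitary.coe_star_mul_self _)
  conv_lhs => rw [eq_conj_diagonal_eigenvalues hB]
  rw [← smul_mul_assoc, ← mul_smul_comm, ← hV, Matrix.exp_conj _ _
    (Unitary.isUnit_coe (U := hB.eigenvectorUnitary)), ← Matrix.diagonal_smul,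
    Matrix.exp_diagonal]
  congr 3
  funext i
  rw [Pi.coe_exp, ← Complex.exp_eq_exp_ℂ]
  rfl

theorem trace_exp_smul {B : Matrix ι ι ℂ} (hB : B.IsHermitian) (t : ℝ) :
    (NormedSpace.exp ((t : ℂ) • B)).trace =
      ((∑ i, Real.exp (t * hB.eigenvalues i) : ℝ) : ℂ) := by
  rw [exp_smul_eq_conj_diagonal hB, Matrix.trace_mul_comm, ← mul_assoc,
    Unitary.coe_star_mul_self, one_mul, Matrix.trace_diagonal]
  push_cast
  rfl

/-- **Peierls inequality** for the diagonal entries in a unitary basis. -/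
theorem sum_exp_diag_le {B : Matrix ι ι ℂ} (hB : B.IsHermitian) {U : Matrix ι ι ℂ}
    (hU : star U * U = 1) (t : ℝ) :
    ∑ j, Real.exp (t * ((star U * B * U) j j).re) ≤ ∑ i, Real.exp (t * hB.eigenvalues i) := by
  set V : Matrix ι ι ℂ := (hB.eigenvectorUnitary : Matrix ι ι ℂ) with hV
  have hVV : star V * V = 1 := Unitary.coe_star_mul_self _
  have hVV' : V * star V = 1 := Unitary.coe_mul_star_self _
  -- `W` is the change of basis between `U` and the eigenbasis of `B`, so `‖W i j‖ ^ 2` is doubly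
  -- stochastic. The column sums make it a family of Jensen weights, and the row sums collapse the
  -- bound to the spectrum.
  set W : Matrix ι ι ℂ := star V * U with hW
  have hWW : star W * W = 1 := by
    rw [hW, star_mul, star_star, mul_assoc, ← mul_assoc V, hVV', one_mul, hU]
  have hWW' : W * star W = 1 := mul_eq_one_comm.mp hWW
  have hcol : ∀ j, ∑ i, ‖W i j‖ ^ 2 = 1 := by
    intro j
    have h := congrFun (congrFun hWW j) j
    rw [Matrix.mul_apply, Matrix.one_apply_eq] at h
    rw [← Complex.ofReal_inj, Complex.ofReal_one, ← h]
    push_cast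
    exact Finset.sum_congr rfl fun i _ => by
      rw [← Complex.conj_mul', Matrix.star_apply, Complex.star_def]
  have hrow : ∀ i, ∑ j, ‖W i j‖ ^ 2 = 1 := by
    intro i
    have h := congrFun (congrFun hWW' i) i
    rw [Matrix.mul_apply, Matrix.one_apply_eq] at h
    rw [← Complex.ofReal_inj, Complex.ofReal_one, ← h]
    push_cast
    exact Finset.sum_congr rfl fun i _ => by
      rw [← Complex.mul_conj', Matrix.star_apply, Complex.star_def]
  have hdiag : ∀ j, ((star U * B * U) j j).re = ∑ i, ‖W i j‖ ^ 2 * hB.eigenvalues i := by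
    intro j
    have h1 : star U * B * U =
        star W * (Matrix.diagonal (fun i => (hB.eigenvalues i : ℂ)) * W) := by
      conv_lhs => rw [eq_conj_diagonal_eigenvalues hB]
      rw [hW, star_mul, star_star]
      simp only [mul_assoc, hV]
    rw [h1, Matrix.mul_apply, ← Complex.ofReal_re (∑ i, ‖W i j‖ ^ 2 * hB.eigenvalues i)]
    congr 1
    push_cast
    refine Finset.sum_congr rfl fun i _ => ?_
    rw [Matrix.diagonal_mul, ← Complex.conj_mul', Matrix.star_apply, Complex.star_def]
    ring
  calc ∑ j, Real.exp (t * ((star U * B * U) j j).re)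
      ≤ ∑ j, ∑ i, ‖W i j‖ ^ 2 * Real.exp (t * hB.eigenvalues i) := by
        refine Finset.sum_le_sum fun j _ => ?_
        have h := convexOn_exp.map_sum_le (t := Finset.univ) (w := fun i => ‖W i j‖ ^ 2)
          (p := fun i => t * hB.eigenvalues i) (fun i _ => sq_nonneg _) (hcol j)
          (fun i _ => Set.mem_univ _)
        simp only [smul_eq_mul] at h
        rw [hdiag, Finset.mul_sum]
        convert h using 3
        ring
    _ = ∑ i, Real.exp (t * hB.eigenvalues i) := by
        rw [Finset.sum_comm]
        refine Finset.sum_congr rfl fun i _ => ?_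
        rw [← Finset.sum_mul, hrow, one_mul]

theorem abs_eigenvalues_le_norm_toEuclideanCLM {B : Matrix ι ι ℂ} (hB : B.IsHermitian) (i : ι) :
    |hB.eigenvalues i| ≤ ‖Matrix.toEuclideanCLM (n := ι) (𝕜 := ℂ) B‖ := by
  have h := (Matrix.toEuclideanCLM (n := ι) (𝕜 := ℂ) B).le_opNorm (hB.eigenvectorBasis i)
  have h1 : Matrix.toEuclideanCLM (n := ι) (𝕜 := ℂ) B (hB.eigenvectorBasis i) =
      hB.eigenvalues i • hB.eigenvectorBasis i := by
    ext1
    simpa using congrFun (hB.mulVec_eigenvectorBasis i) _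
  rw [h1, norm_smul, OrthonormalBasis.norm_eq_one] at h
  simpa using h

end Spectral

/-! ### Translation invariance of the diagonal entries -/

section Translation

variable {d n : ℕ}

theorem translation_mul_mul_star [NeZero n] (A : Op d n) :
    translation d n * A * star (translation d n) = translateOp 1 A := by
  have h1 : ∀ x y : Config d n, x = (fun l => y ((finRotate n).symm l)) ↔
      (fun i => x (i + 1)) = y := by
    intro x y
    constructor
    · rintro rfl
      funext i
      simp only [← finRotate_apply, Equiv.symm_apply_apply]
    · rintro rfl
      funext i
      simp only [← finRotate_apply, Equiv.apply_symm_apply]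
  ext x y
  simp only [Matrix.mul_apply, Matrix.star_apply, translation, Matrix.of_apply, h1, translateOp,
    Matrix.submatrix_apply]
  simp

theorem translation_mul_star (d n : ℕ) [NeZero n] :
    translation d n * star (translation d n) = 1 := by
  have h := translation_mul_mul_star (1 : Op d n)
  rw [mul_one] at h
  rw [h]
  refine Matrix.submatrix_one _ fun x y h => ?_
  funext i
  simpa using congrFun h (i - 1)

variable {H : Op d n} (hH : H.IsHermitian)

/-- The operator `A` in the eigenbasis of `H`. -/
noncomputable def eigenMatrix (A : Op d n) : Op d n :=
  star (hH.eigenvectorUnitary : Op d n) * A * (hH.eigenvectorUnitary : Op d n)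

theorem eigenMatrix_mul (A B : Op d n) :
    eigenMatrix hH (A * B) = eigenMatrix hH A * eigenMatrix hH B := by
  have h : (hH.eigenvectorUnitary : Op d n) * star (hH.eigenvectorUnitary : Op d n) = 1 :=
    Unitary.coe_mul_star_self _
  simp only [eigenMatrix, mul_assoc]
  rw [← mul_assoc (hH.eigenvectorUnitary : Op d n) (star _), h, one_mul]

theorem eigenMatrix_star (A : Op d n) : eigenMatrix hH (star A) = star (eigenMatrix hH A) := by
  simp only [eigenMatrix, star_mul, star_star, mul_assoc]

theorem eigenMatrix_one : eigenMatrix hH (1 : Op d n) = 1 := by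
  rw [eigenMatrix, mul_one]
  exact Unitary.coe_star_mul_self _

theorem eigenMatrix_self :
    eigenMatrix hH H = Matrix.diagonal fun i => (hH.eigenvalues i : ℂ) := by
  have h : star (hH.eigenvectorUnitary : Op d n) * (hH.eigenvectorUnitary : Op d n) = 1 :=
    Unitary.coe_star_mul_self _
  have h' := congrArg (eigenMatrix hH) (eq_conj_diagonal_eigenvalues hH)
  rw [h', eigenMatrix]
  simp only [mul_assoc, h, mul_one]
  rw [← mul_assoc, h, one_mul]

/-- In the eigenbasis of `H` the translation commutes with a diagonal matrix whose entries are
distinct, so it is itself diagonal. Being unitary it has unimodular entries, and these phases cancel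
in a diagonal entry of the conjugated operator. -/
theorem eigenMatrix_translateOp_one [NeZero n] (hT : IsTranslationInvariant H)
    (hE : HasNondegenerateSpectrum hH) (A : Op d n) (j : Config d n) :
    eigenMatrix hH (translateOp 1 A) j j = eigenMatrix hH A j j := by
  set T := eigenMatrix hH (translation d n) with hTdef
  have hdiag : ∀ i j, i ≠ j → T i j = 0 := by
    intro i j hij
    have h := congrArg (eigenMatrix hH) hT
    rw [eigenMatrix_mul, eigenMatrix_mul, eigenMatrix_self] at h
    have h := congrFun (congrFun h i) j
    rw [Matrix.diagonal_mul, Matrix.mul_diagonal, ← hTdef] at h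
    have hne : (hH.eigenvalues i : ℂ) ≠ hH.eigenvalues j := by
      exact_mod_cast fun h => hij (hE h)
    by_contra h0
    exact hne (mul_right_cancel₀ h0 (by rw [← h, mul_comm]))
  have hone : T j j * star (T j j) = 1 := by
    have h := congrArg (eigenMatrix hH) (translation_mul_star d n)
    rw [eigenMatrix_mul, eigenMatrix_star, eigenMatrix_one] at h
    have h := congrFun (congrFun h j) j
    rwa [Matrix.mul_apply, Finset.sum_eq_single j (fun b _ hb => by
      rw [← hTdef, hdiag j b hb.symm, zero_mul]) (by simp), Matrix.one_apply_eq] at h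
  rw [← translation_mul_mul_star, eigenMatrix_mul, eigenMatrix_mul, eigenMatrix_star, ← hTdef,
    Matrix.mul_apply, Finset.sum_eq_single j (fun b _ hb => by
      rw [Matrix.star_apply, hdiag j b hb.symm, star_zero, mul_zero]) (by simp),
    Matrix.mul_apply, Finset.sum_eq_single j (fun b _ hb => by
      rw [hdiag j b hb.symm, zero_mul]) (by simp), Matrix.star_apply, mul_right_comm, hone,
    one_mul]

theorem eigenMatrix_translateOp [NeZero n] (hT : IsTranslationInvariant H)
    (hE : HasNondegenerateSpectrum hH) (A : Op d n) (s : ℕ) (j : Config d n) :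
    eigenMatrix hH (translateOp (Fin.ofNat n s) A) j j = eigenMatrix hH A j j := by
  induction s generalizing A with
  | zero =>
    have h : translateOp (Fin.ofNat n 0) A = A := by
      ext x y
      simp [translateOp]
    rw [h]
  | succ s ih =>
    have h : ∀ i : Fin n, i + Fin.ofNat n (s + 1) = i + 1 + Fin.ofNat n s := by
      intro i
      have : Fin.ofNat n (s + 1) = 1 + Fin.ofNat n s := by
        rw [Fin.ext_iff, Fin.val_add]
        simp [Fin.ofNat, add_comm]
      rw [this]
      obtain ⟨m, rfl⟩ := Nat.exists_eq_succ_of_ne_zero (NeZero.ne n)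
      rw [add_assoc]
    have h' : translateOp (Fin.ofNat n (s + 1)) A =
        translateOp (Fin.ofNat n s) (translateOp 1 A) := by
      ext x y
      simp only [translateOp, Matrix.submatrix_apply, h]
    rw [h', ih, eigenMatrix_translateOp_one hH hT hE]

end Translation

/-! ### The infinite-time average -/

section

theorem tendsto_average_exp_mul_I (ω : ℝ) :
    Tendsto (fun τ : ℝ => (1 / (τ : ℂ)) * ∫ t in (0 : ℝ)..τ, Complex.exp (Complex.I * ω * t))
      atTop (𝓝 (if ω = 0 then 1 else 0)) := by
  split_ifs with h
  · subst h
    refine tendsto_const_nhds.congr' ?_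
    filter_upwards [eventually_gt_atTop 0] with τ hτ
    have : (τ : ℂ) ≠ 0 := by exact_mod_cast hτ.ne'
    simp [this]
  · have hc : Complex.I * (ω : ℂ) ≠ 0 := mul_ne_zero Complex.I_ne_zero (by exact_mod_cast h)
    have hb : Tendsto (fun τ : ℝ => (2 / |ω|) * τ⁻¹) atTop (𝓝 0) := by
      simpa using tendsto_inv_atTop_zero.const_mul (2 / |ω|)
    refine squeeze_zero_norm' ?_ hb
    filter_upwards [eventually_gt_atTop 0] with τ hτ
    rw [integral_exp_mul_complex hc, norm_mul, norm_div, norm_div, norm_mul Complex.I,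
      Complex.norm_I, one_mul, norm_one, Complex.norm_real, Complex.norm_real, Real.norm_eq_abs,
      Real.norm_eq_abs, abs_of_pos hτ]
    have h1 : ∀ s : ℝ, ‖Complex.exp (Complex.I * ω * s)‖ = 1 := by
      intro s
      rw [mul_assoc, mul_comm, ← Complex.ofReal_mul]
      exact Complex.norm_exp_ofReal_mul_I _
    have h2 : ‖Complex.exp (Complex.I * ω * τ) - Complex.exp (Complex.I * ω * (0 : ℝ))‖ ≤ 2 := by
      refine (norm_sub_le _ _).trans ?_
      rw [h1, h1]
      norm_num
    rw [one_div, mul_comm]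
    gcongr

variable {d n : ℕ} {H : Op d n} (hH : H.IsHermitian)

/-- The components of a product vector in the eigenbasis of `H`. -/
noncomputable def eigenCoeff (ψ : Fin n → SpinState d) (j : Config d n) : ℂ :=
  ∑ x, star (hH.eigenvectorUnitary : Op d n) j x * productVec ψ x

theorem expVal_conj (X : Op d n) (ψ : Fin n → SpinState d) :
    expVal ((hH.eigenvectorUnitary : Op d n) * X * star (hH.eigenvectorUnitary : Op d n)) ψ =
      ∑ j, ∑ l, star (eigenCoeff hH ψ j) * X j l * eigenCoeff hH ψ l := by
  have h : eigenCoeff hH ψ =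
      (star (hH.eigenvectorUnitary : Op d n)).mulVec (productVec ψ) := rfl
  have h' : star (eigenCoeff hH ψ) =
      Matrix.vecMul (star (productVec ψ)) (hH.eigenvectorUnitary : Op d n) := by
    rw [h, Matrix.star_mulVec, Matrix.star_eq_conjTranspose, Matrix.conjTranspose_conjTranspose]
  rw [expVal, mul_assoc, ← Matrix.mulVec_mulVec, ← Matrix.mulVec_mulVec, ← h,
    Matrix.dotProduct_mulVec, ← h', dotProduct]
  refine Finset.sum_congr rfl fun j _ => ?_
  rw [Matrix.mulVec, dotProduct, Finset.mul_sum]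
  exact Finset.sum_congr rfl fun l _ => by rw [Pi.star_apply, mul_assoc]

theorem heisenberg_eq (A : Op d n) (t : ℝ) :
    heisenberg H A t = (hH.eigenvectorUnitary : Op d n) *
      Matrix.of (fun j l => Complex.exp
        (Complex.I * ((hH.eigenvalues j - hH.eigenvalues l : ℝ) : ℂ) * t) *
          eigenMatrix hH A j l) *
      star (hH.eigenvectorUnitary : Op d n) := by
  have h : Matrix.of (fun j l => Complex.exp
        (Complex.I * ((hH.eigenvalues j - hH.eigenvalues l : ℝ) : ℂ) * t) *
          eigenMatrix hH A j l) =
      Matrix.diagonal (fun i => Complex.exp (Complex.I * t * hH.eigenvalues i)) *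
        eigenMatrix hH A *
      Matrix.diagonal (fun i => Complex.exp (-(Complex.I * t) * hH.eigenvalues i)) := by
    ext j l
    rw [Matrix.mul_diagonal, Matrix.diagonal_mul, mul_right_comm, ← Complex.exp_add,
      Matrix.of_apply]
    congr 2
    push_cast
    ring
  rw [h, heisenberg, exp_smul_eq_conj_diagonal hH, exp_smul_eq_conj_diagonal hH, eigenMatrix]
  simp only [mul_assoc]

theorem norm_eigenCoeff (ψ : Fin n → SpinState d) : ∑ j, ‖eigenCoeff hH ψ j‖ ^ 2 = 1 := by
  have hU : (hH.eigenvectorUnitary : Op d n) * star (hH.eigenvectorUnitary : Op d n) = 1 :=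
    Unitary.coe_mul_star_self _
  have h := expVal_conj hH 1 ψ
  rw [mul_one, hU] at h
  have h1 : expVal (1 : Op d n) ψ = ((∑ x, ‖productVec ψ x‖ ^ 2 : ℝ) : ℂ) := by
    rw [expVal, Matrix.one_mulVec, dotProduct]
    push_cast
    exact Finset.sum_congr rfl fun x _ => by
      rw [← Complex.conj_mul', Pi.star_apply, Complex.star_def]
  rw [h1, norm_productVec] at h
  rw [← Complex.ofReal_inj, h]
  push_cast
  refine Finset.sum_congr rfl fun j _ => ?_
  rw [Finset.sum_eq_single j (fun l _ hl => by
    rw [Matrix.one_apply_ne hl.symm, mul_zero, zero_mul]) (by simp), Matrix.one_apply_eq, mul_one,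
    ← Complex.conj_mul', Complex.star_def]

theorem continuous_eigenCoeff (j : Config d n) :
    Continuous fun ψ : Fin n → SpinState d => eigenCoeff hH ψ j :=
  continuous_finsetSum _ fun x _ => continuous_const.mul (continuous_productVec x)

/-- The mean weight of a random product state on an eigenvector of `H`. -/
theorem integral_norm_eigenCoeff (hd : 1 ≤ d) (j : Config d n) :
    ∫ ψ, ‖eigenCoeff hH ψ j‖ ^ 2 ∂randomProductState d n = 1 / (d : ℝ) ^ n := by
  simp only [eigenCoeff]
  rw [integral_overlap hd]
  congr 1
  have h : star (hH.eigenvectorUnitary : Op d n) * (hH.eigenvectorUnitary : Op d n) = 1 :=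
    Unitary.coe_star_mul_self _
  have h := congrFun (congrFun h j) j
  rw [Matrix.mul_apply, Matrix.one_apply_eq] at h
  rw [← Complex.ofReal_inj, Complex.ofReal_one, ← h]
  push_cast
  refine Finset.sum_congr rfl fun x _ => ?_
  rw [← Complex.mul_conj', Matrix.star_apply, Complex.star_def, Complex.conj_conj]

/-- The pair `(j, l)` oscillates with frequency `Eⱼ - Eₗ`, and only zero frequencies survive the
average. Simplicity of the spectrum leaves exactly the pairs `j = l`. Degenerate gaps do no harm. -/
theorem tendsto_finiteTimeAverage (hE : HasNondegenerateSpectrum hH) (A : Op d n)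
    (ψ : Fin n → SpinState d) :
    Tendsto (finiteTimeAverage H A ψ) atTop
      (𝓝 (∑ j, (‖eigenCoeff hH ψ j‖ ^ 2 : ℝ) * eigenMatrix hH A j j)) := by
  have h1 : ∀ τ, finiteTimeAverage H A ψ τ = ∑ j, ∑ l,
      star (eigenCoeff hH ψ j) * eigenMatrix hH A j l * eigenCoeff hH ψ l *
        ((1 / (τ : ℂ)) * ∫ t in (0 : ℝ)..τ, Complex.exp
          (Complex.I * ((hH.eigenvalues j - hH.eigenvalues l : ℝ) : ℂ) * t)) := by
    intro τ
    simp only [finiteTimeAverage, heisenberg_eq hH, expVal_conj, Matrix.of_apply]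
    have hc : ∀ j l, Continuous fun t : ℝ => star (eigenCoeff hH ψ j) *
        (Complex.exp (Complex.I * ((hH.eigenvalues j - hH.eigenvalues l : ℝ) : ℂ) * t) *
          eigenMatrix hH A j l) * eigenCoeff hH ψ l := by
      intro j l
      fun_prop
    rw [intervalIntegral.integral_finsetSum fun j _ =>
      (continuous_finsetSum _ fun l _ => hc j l).intervalIntegrable _ _, Finset.mul_sum]
    refine Finset.sum_congr rfl fun j _ => ?_
    rw [intervalIntegral.integral_finsetSum fun l _ => (hc j l).intervalIntegrable _ _,
      Finset.mul_sum]
    refine Finset.sum_congr rfl fun l _ => ?_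
    conv_rhs => rw [mul_left_comm, ← intervalIntegral.integral_const_mul]
    congr 1
    refine intervalIntegral.integral_congr fun t _ => ?_
    ring
  have h2 : Tendsto (finiteTimeAverage H A ψ) atTop (𝓝 (∑ j, ∑ l,
      star (eigenCoeff hH ψ j) * eigenMatrix hH A j l * eigenCoeff hH ψ l *
        (if hH.eigenvalues j - hH.eigenvalues l = 0 then 1 else 0))) := by
    refine Tendsto.congr (fun τ => (h1 τ).symm) ?_
    exact tendsto_finsetSum _ fun j _ => tendsto_finsetSum _ fun l _ =>
      (tendsto_average_exp_mul_I _).const_mul _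
  convert h2 using 2
  refine Finset.sum_congr rfl fun j _ => ?_
  rw [Finset.sum_eq_single j]
  · rw [sub_self, if_pos rfl, mul_one]
    push_cast
    rw [← Complex.conj_mul', Complex.star_def]
    ring
  · intro l _ hl
    rw [if_neg (sub_ne_zero.mpr fun h => hl (hE h).symm), mul_zero]
  · simp

theorem timeAverage_eq (hE : HasNondegenerateSpectrum hH) (A : Op d n)
    (ψ : Fin n → SpinState d) :
    timeAverage H A ψ = ∑ j, (‖eigenCoeff hH ψ j‖ ^ 2 : ℝ) * eigenMatrix hH A j j :=
  (tendsto_finiteTimeAverage hH hE A ψ).limUnder_eq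

theorem continuous_timeAverage (hE : HasNondegenerateSpectrum hH) (A : Op d n) :
    Continuous fun ψ : Fin n → SpinState d => timeAverage H A ψ := by
  simp only [timeAverage_eq hH hE]
  have := continuous_eigenCoeff hH
  fun_prop

end

/-! ### Exponential moments of the diagonal entries -/

section

variable {d n : ℕ}

/-- Translating is conjugation by a permutation matrix. -/
theorem exp_translateOp [NeZero n] (c : Fin n) (A : Op d n) :
    NormedSpace.exp (translateOp c A) = translateOp c (NormedSpace.exp A) := by
  let e : Equiv.Perm (Config d n) := (Equiv.addRight c).symm.arrowCongr (Equiv.refl (Fin d))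
  let P : Op d n := e.toPEquiv.toMatrix
  let Q : Op d n := e.symm.toPEquiv.toMatrix
  have hPQ : P * Q = 1 := by
    rw [← PEquiv.toMatrix_trans, ← Equiv.toPEquiv_trans]
    simp
  have h : ∀ X : Op d n, translateOp c X = P * X * P⁻¹ := by
    intro X
    rw [Matrix.inv_eq_right_inv hPQ, PEquiv.toMatrix_toPEquiv_mul, PEquiv.mul_toMatrix_toPEquiv]
    rfl
  rw [h, h, Matrix.exp_conj _ _ (IsUnit.of_mul_eq_one Q hPQ)]

theorem trace_translateOp [NeZero n] (c : Fin n) (A : Op d n) :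
    (translateOp c A).trace = A.trace := by
  let e : Equiv.Perm (Config d n) := (Equiv.addRight c).symm.arrowCongr (Equiv.refl (Fin d))
  exact Equiv.sum_comp e fun x => A x x

/-- The sum of `p` translates of `A` with spacing `k + 1`. -/
noncomputable def spacedSum [NeZero n] (k p : ℕ) (A : Op d n) : Op d n :=
  ∑ s ∈ Finset.range p, translateOp (Fin.ofNat n (s * (k + 1))) A

theorem isHermitian_spacedSum [NeZero n] (k p : ℕ) {A : Op d n} (hA : A.IsHermitian) :
    (spacedSum k p A).IsHermitian := by
  rw [spacedSum, Matrix.IsHermitian, Matrix.conjTranspose_sum]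
  exact Finset.sum_congr rfl fun s _ => (hA.submatrix _).eq

/-- Induction on `p`: the new translate is disjoint from the earlier ones, so the exponential splits
and the normalized trace is multiplicative. The support of the partial sum is carried along because
the next step needs it. -/
theorem trace_exp_spacedSum [NeZero n] (hd : 1 ≤ d) {k : ℕ} {l : Fin n} {A : Op d n}
    (hA : IsSupportedOn A (region l k)) (t : ℂ) {p : ℕ} (hp : p ≤ n / (k + 1)) :
    ActsOn (spacedSum k p A) ((Finset.range p).biUnion fun s =>
      Finset.univ.filter fun i : Fin n => i - Fin.ofNat n (s * (k + 1)) ∈ region l k) ∧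
    (NormedSpace.exp (t • spacedSum k p A)).trace =
      (d : ℂ) ^ n * ((NormedSpace.exp (t • A)).trace / (d : ℂ) ^ n) ^ p := by
  have hd0 : (d : ℂ) ^ n ≠ 0 := pow_ne_zero _ (by exact_mod_cast (by omega : d ≠ 0))
  induction p with
  | zero =>
    refine ⟨ActsOn.zero, ?_⟩
    simp [spacedSum, NormedSpace.exp_zero]
  | succ p ih =>
    obtain ⟨h1, h2⟩ := ih (by omega)
    have hB := (isSupportedOn_translateOp hA (Fin.ofNat n (p * (k + 1)))).actsOn
    have hsum : spacedSum k (p + 1) A =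
        spacedSum k p A + translateOp (Fin.ofNat n (p * (k + 1))) A := Finset.sum_range_succ _ _
    have hdisj : Disjoint ((Finset.range p).biUnion fun s =>
        Finset.univ.filter fun i : Fin n => i - Fin.ofNat n (s * (k + 1)) ∈ region l k)
        (Finset.univ.filter fun i : Fin n => i - Fin.ofNat n (p * (k + 1)) ∈ region l k) := by
      rw [Finset.disjoint_biUnion_left]
      intro s hs
      exact disjoint_translate_region l (Finset.mem_range.mp hs) (by omega)
    constructor
    · rw [hsum]
      refine (h1.mono ?_).add (hB.mono ?_)
      · exact Finset.biUnion_subset_biUnion_of_subset_left _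
          (Finset.range_subset_range.mpr (Nat.le_succ p))
      · exact Finset.subset_biUnion_of_mem (fun s : ℕ =>
          Finset.univ.filter fun i : Fin n => i - Fin.ofNat n (s * (k + 1)) ∈ region l k)
          (Finset.self_mem_range_succ p)
    · have h3 := (h1.smul t).exp.trace_mul (hB.smul t).exp hdisj
      have h4 : t • translateOp (Fin.ofNat n (p * (k + 1))) A =
          translateOp (Fin.ofNat n (p * (k + 1))) (t • A) := rfl
      rw [← Matrix.exp_add_of_commute _ _ ((h1.smul t).commute (hB.smul t) hdisj), ← smul_add,
        ← hsum, h2, h4, exp_translateOp, trace_translateOp] at h3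
      apply mul_left_cancel₀ hd0
      rw [h3, pow_succ]
      field_simp

/-- The moment generating function of the diagonal entries of a local Hermitian operator in the
eigenbasis of a translation-invariant Hamiltonian. -/
theorem sum_exp_eigenMatrix_le (hd : 1 ≤ d) {H : Op d n} (hH : H.IsHermitian)
    (hT : IsTranslationInvariant H) (hE : HasNondegenerateSpectrum hH) {k : ℕ} {A : Op d n}
    (hloc : IsLocal k A) (hA : A.IsHermitian) (htr : A.trace = 0) {M : ℝ} (hM : 0 < M)
    (hAM : opNorm A ≤ M) (hk : 0 < n / (k + 1)) (r : ℝ) :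
    ∑ j, Real.exp (r * (eigenMatrix hH A j j).re) ≤
      (d : ℝ) ^ n * Real.exp (r ^ 2 * M ^ 2 / (2 * (n / (k + 1) : ℕ))) := by
  obtain ⟨l, hl⟩ := hloc
  have : NeZero n := ⟨fun h => by simp [h] at hk⟩
  set m := n / (k + 1) with hm
  have hm0 : (0 : ℝ) < m := by exact_mod_cast hk
  have hd0 : (0 : ℝ) < (d : ℝ) ^ n := pow_pos (by exact_mod_cast hd) _
  set B := spacedSum k m A with hBdef
  have hB : B.IsHermitian := isHermitian_spacedSum k m hA
  -- All `m` translates have the same diagonal entries as `A`, so a diagonal entry of `A` is that of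
  -- `B` divided by `m`.
  have hdiag : ∀ j, r * (eigenMatrix hH A j j).re =
      r / m * ((star (hH.eigenvectorUnitary : Op d n) * B * hH.eigenvectorUnitary) j j).re := by
    intro j
    have h1 : (star (hH.eigenvectorUnitary : Op d n) * B * hH.eigenvectorUnitary) j j =
        m * eigenMatrix hH A j j := by
      rw [hBdef, spacedSum, Finset.mul_sum, Finset.sum_mul, Matrix.sum_apply]
      have h2 : ∀ s ∈ Finset.range m, (star (hH.eigenvectorUnitary : Op d n) *
          translateOp (Fin.ofNat n (s * (k + 1))) A * hH.eigenvectorUnitary) j j =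
          eigenMatrix hH A j j := fun s _ => eigenMatrix_translateOp hH hT hE A _ j
      rw [Finset.sum_congr rfl h2]
      simp
    rw [h1, ← Complex.ofReal_natCast, Complex.re_ofReal_mul]
    field_simp
  have hhoeff : ∑ i, Real.exp (r / m * hA.eigenvalues i) ≤
      (d : ℝ) ^ n * Real.exp ((r / m) ^ 2 * M ^ 2 / 2) := by
    have h := sum_exp_mul_le hM
      (fun i => (abs_eigenvalues_le_norm_toEuclideanCLM hA i).trans hAM) (by
        have := hA.trace_eq_sum_eigenvalues
        rw [htr] at this
        rw [← Complex.ofReal_inj, Complex.ofReal_zero, this]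
        push_cast
        rfl) (r / m)
    simpa using h
  have hexp : ∑ i, Real.exp (r / m * hB.eigenvalues i) =
      (d : ℝ) ^ n * ((∑ i, Real.exp (r / m * hA.eigenvalues i)) / (d : ℝ) ^ n) ^ m := by
    have h := (trace_exp_spacedSum hd hl ((r / m : ℝ) : ℂ) le_rfl).2
    rw [trace_exp_smul hA, ← hm, trace_exp_smul hB] at h
    exact_mod_cast h
  calc ∑ j, Real.exp (r * (eigenMatrix hH A j j).re)
      = ∑ j, Real.exp (r / m *
        ((star (hH.eigenvectorUnitary : Op d n) * B * hH.eigenvectorUnitary) j j).re) := by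
        simp only [hdiag]
    _ ≤ ∑ i, Real.exp (r / m * hB.eigenvalues i) :=
        sum_exp_diag_le hB (Unitary.coe_star_mul_self _) _
    _ = (d : ℝ) ^ n * ((∑ i, Real.exp (r / m * hA.eigenvalues i)) / (d : ℝ) ^ n) ^ m := hexp
    -- Each of the `m` factors costs `(r/m)²M²/2` in the exponent, so their product keeps a net gain
    -- of `1/m`.
    _ ≤ (d : ℝ) ^ n * (Real.exp ((r / m) ^ 2 * M ^ 2 / 2)) ^ m := by
        gcongr
        rw [div_le_iff₀ hd0, mul_comm]
        exact hhoeff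
    _ = (d : ℝ) ^ n * Real.exp (r ^ 2 * M ^ 2 / (2 * m)) := by
        rw [← Real.exp_nat_mul]
        congr 2
        field_simp

end

/-! ### Reduction to Hermitian operators and exponential moments of the time average -/

section

variable {d n : ℕ}

/-- The Hermitian part of an operator. -/
noncomputable def hermitianPart (A : Op d n) : Op d n := (2⁻¹ : ℂ) • (A + star A)

theorem isHermitian_hermitianPart (A : Op d n) : (hermitianPart A).IsHermitian := by
  rw [hermitianPart, Matrix.IsHermitian, ← Matrix.star_eq_conjTranspose, star_smul, star_add,
    star_star, add_comm]
  simp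

theorem opNorm_hermitianPart_le (A : Op d n) : opNorm (hermitianPart A) ≤ opNorm A := by
  rw [opNorm, hermitianPart, map_smul, map_add, map_star, norm_smul, opNorm]
  refine (mul_le_mul_of_nonneg_left (norm_add_le _ _) (norm_nonneg _)).trans (le_of_eq ?_)
  rw [ContinuousLinearMap.star_eq_adjoint, LinearIsometryEquiv.norm_map, norm_inv, Complex.norm_ofNat]
  ring

theorem trace_hermitianPart {A : Op d n} (h : A.trace = 0) : (hermitianPart A).trace = 0 := by
  rw [hermitianPart, Matrix.trace_smul, Matrix.trace_add, Matrix.star_eq_conjTranspose,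
    Matrix.trace_conjTranspose, h]
  simp

theorem IsLocal.hermitianPart {k : ℕ} {A : Op d n} (h : IsLocal k A) :
    IsLocal k (hermitianPart A) := by
  obtain ⟨l, B, hB⟩ := h
  refine ⟨l, (2⁻¹ : ℂ) • (B + star B), fun x y => ?_⟩
  have hsymm : (∀ i, i ∉ region l k → y i = x i) ↔ ∀ i, i ∉ region l k → x i = y i :=
    forall₂_congr fun i _ => eq_comm
  rw [SpinChain.hermitianPart, Matrix.smul_apply, Matrix.add_apply, Matrix.star_apply, hB, hB]
  simp only [hsymm]
  split_ifs
  · rw [Matrix.smul_apply, Matrix.add_apply, Matrix.star_apply]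
  · simp

theorem IsLocal.smul {k : ℕ} {A : Op d n} (h : IsLocal k A) (c : ℂ) : IsLocal k (c • A) := by
  obtain ⟨l, B, hB⟩ := h
  refine ⟨l, c • B, fun x y => ?_⟩
  rw [Matrix.smul_apply, hB]
  split_ifs
  · rfl
  · exact smul_zero c

/-- The real parts of the diagonal entries see only the Hermitian part. Applied to `u • A` for
phases `u`, this reduces a non-Hermitian `A` to the Hermitian bound. -/
theorem eigenMatrix_hermitianPart_re {H : Op d n} (hH : H.IsHermitian) (A : Op d n)
    (j : Config d n) :
    (eigenMatrix hH (hermitianPart A) j j).re = (eigenMatrix hH A j j).re := by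
  have h : eigenMatrix hH (hermitianPart A) =
      (2⁻¹ : ℂ) • (eigenMatrix hH A + star (eigenMatrix hH A)) := by
    rw [← eigenMatrix_star]
    simp only [eigenMatrix, hermitianPart, mul_smul_comm, smul_mul_assoc, mul_add, add_mul]
  rw [h, Matrix.smul_apply, Matrix.add_apply, Matrix.star_apply, smul_eq_mul, Complex.star_def,
    Complex.add_conj, ← Complex.ofReal_ofNat, ← Complex.ofReal_inv, ← Complex.ofReal_mul,
    Complex.ofReal_re]
  ring

/-- The moment generating function of the time-averaged expectation value in a random product
state. -/
theorem integral_exp_timeAverage_le (hd : 1 ≤ d) {H : Op d n} (hH : H.IsHermitian)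
    (hT : IsTranslationInvariant H) (hE : HasNondegenerateSpectrum hH) {k : ℕ} {A : Op d n}
    (hloc : IsLocal k A) (htr : A.trace = 0) {M : ℝ} (hM : 0 < M)
    (hAM : opNorm A ≤ M) (hk : 0 < n / (k + 1)) {u : ℂ} (hu : ‖u‖ = 1) (r : ℝ) :
    ∫ ψ, Real.exp (r * (u * timeAverage H A ψ).re) ∂randomProductState d n ≤
      Real.exp (r ^ 2 * M ^ 2 / (2 * (n / (k + 1) : ℕ))) := by
  have hd0 : (0 : ℝ) < (d : ℝ) ^ n := pow_pos (by exact_mod_cast hd) _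
  have hcont := continuous_eigenCoeff hH
  have hX := continuous_timeAverage hH hE A
  set a : Config d n → ℝ := fun j => (u * eigenMatrix hH A j j).re
  have hre : ∀ ψ, (u * timeAverage H A ψ).re = ∑ j, ‖eigenCoeff hH ψ j‖ ^ 2 * a j := by
    intro ψ
    rw [timeAverage_eq hH hE, Finset.mul_sum, Complex.re_sum]
    exact Finset.sum_congr rfl fun j _ => by rw [mul_left_comm, Complex.re_ofReal_mul]
  -- For fixed `ψ` the weights `‖eigenCoeff hH ψ j‖ ^ 2` form a probability vector. Once `exp` is
  -- inside the sum, only their means over `ψ` are needed, never their correlations.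
  have hjensen : ∀ ψ, Real.exp (r * (u * timeAverage H A ψ).re) ≤
      ∑ j, ‖eigenCoeff hH ψ j‖ ^ 2 * Real.exp (r * a j) := by
    intro ψ
    have h := convexOn_exp.map_sum_le (t := Finset.univ) (w := fun j => ‖eigenCoeff hH ψ j‖ ^ 2)
      (p := fun j => r * a j) (fun j _ => sq_nonneg _) (norm_eigenCoeff hH ψ)
      (fun j _ => Set.mem_univ _)
    simp only [smul_eq_mul] at h
    rw [hre, Finset.mul_sum]
    refine le_of_eq_of_le (congrArg Real.exp (Finset.sum_congr rfl fun j _ => ?_)) h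
    exact mul_left_comm _ _ _
  have hlocal : ∑ j, Real.exp (r * a j) ≤
      (d : ℝ) ^ n * Real.exp (r ^ 2 * M ^ 2 / (2 * (n / (k + 1) : ℕ))) := by
    have hnorm : opNorm (u • A) ≤ M := by
      rwa [opNorm, map_smul, norm_smul, hu, one_mul]
    have h := sum_exp_eigenMatrix_le hd hH hT hE (hloc.smul u).hermitianPart
      (isHermitian_hermitianPart _)
      (trace_hermitianPart (by rw [Matrix.trace_smul, htr, smul_zero])) hM
      ((opNorm_hermitianPart_le _).trans hnorm) hk r
    simp only [eigenMatrix_hermitianPart_re] at h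
    convert h using 6
    simp only [eigenMatrix, mul_smul_comm, smul_mul_assoc, Matrix.smul_apply, smul_eq_mul]
  calc ∫ ψ, Real.exp (r * (u * timeAverage H A ψ).re) ∂randomProductState d n
      ≤ ∫ ψ, ∑ j, ‖eigenCoeff hH ψ j‖ ^ 2 * Real.exp (r * a j) ∂randomProductState d n := by
        refine integral_mono (integrable_randomProductState hd ?_)
          (integrable_randomProductState hd ?_) hjensen <;> fun_prop
    _ = (∑ j, Real.exp (r * a j)) / (d : ℝ) ^ n := by
        rw [integral_finsetSum _ fun j _ => integrable_randomProductState hd (by fun_prop),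
          Finset.sum_div]
        refine Finset.sum_congr rfl fun j _ => ?_
        rw [integral_mul_const, integral_norm_eigenCoeff hH hd]
        ring
    _ ≤ Real.exp (r ^ 2 * M ^ 2 / (2 * (n / (k + 1) : ℕ))) := by
        rwa [div_le_iff₀ hd0, mul_comm]

/-! ### Mean and tail of a complex subgaussian variable -/

section Subgaussian

variable {Ω : Type*} [MeasurableSpace Ω] {P : Measure Ω} {X : Ω → ℂ} {σ : ℝ}

/-- From `z ≤ σ exp(z/σ)`, the norm is dominated by exponentials in the four directions `±1`, `±i`.
At `r = 1/σ` each of them has mean at most `exp(1/2)`. -/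
theorem integral_norm_le_of_subgaussian (hX : Integrable (fun ω => ‖X ω‖) P) (hσ : 0 < σ)
    (hint : ∀ (u : ℂ) (r : ℝ), Integrable (fun ω => Real.exp (r * (u * X ω).re)) P)
    (hmgf : ∀ u : ℂ, ‖u‖ = 1 → ∀ r : ℝ,
      ∫ ω, Real.exp (r * (u * X ω).re) ∂P ≤ Real.exp (r ^ 2 * σ ^ 2 / 2)) :
    ∫ ω, ‖X ω‖ ∂P ≤ 4 * Real.exp (1 / 2) * σ := by
  have habs : ∀ y : ℝ, |y| ≤ σ * (Real.exp (σ⁻¹ * y) + Real.exp (σ⁻¹ * -y)) := by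
    intro y
    have h1 : ∀ z : ℝ, z ≤ σ * Real.exp (σ⁻¹ * z) := by
      intro z
      have := Real.add_one_le_exp (σ⁻¹ * z)
      calc z = σ * (σ⁻¹ * z) := by field_simp
        _ ≤ σ * Real.exp (σ⁻¹ * z) := by gcongr; linarith
    rw [mul_add]
    have h2 := h1 y
    have h3 := h1 (-y)
    have h4 : 0 < σ * Real.exp (σ⁻¹ * y) := by positivity
    have h5 : 0 < σ * Real.exp (σ⁻¹ * -y) := by positivity
    exact abs_le.mpr ⟨by linarith, by linarith⟩
  have hbound : ∀ ω, ‖X ω‖ ≤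
      σ * (Real.exp (σ⁻¹ * (1 * X ω).re) + Real.exp (σ⁻¹ * (-1 * X ω).re)) +
      σ * (Real.exp (σ⁻¹ * (-Complex.I * X ω).re) + Real.exp (σ⁻¹ * (Complex.I * X ω).re)) := by
    intro ω
    have h1 := habs (X ω).re
    have h2 := habs (X ω).im
    have h3 := Complex.norm_le_abs_re_add_abs_im (X ω)
    simp only [one_mul, neg_mul, Complex.neg_re, Complex.I_mul_re, neg_neg]
    linarith
  have hone : ∀ u : ℂ, ‖u‖ = 1 → ∫ ω, Real.exp (σ⁻¹ * (u * X ω).re) ∂P ≤ Real.exp (1 / 2) := by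
    intro u hu
    refine (hmgf u hu σ⁻¹).trans (le_of_eq ?_)
    congr 1
    field_simp
  have hpair : ∀ u v : ℂ, Integrable (fun ω =>
      σ * (Real.exp (σ⁻¹ * (u * X ω).re) + Real.exp (σ⁻¹ * (v * X ω).re))) P :=
    fun u v => ((hint u _).add (hint v _)).const_mul σ
  refine (integral_mono hX ((hpair _ _).add (hpair _ _)) hbound).trans ?_
  simp only [Pi.add_apply]
  rw [integral_add (hpair _ _) (hpair _ _), integral_const_mul, integral_const_mul,
    integral_add (hint _ _) (hint _ _), integral_add (hint _ _) (hint _ _)]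
  have h1 := hone 1 (by simp)
  have h2 := hone (-1) (by simp)
  have h3 := hone (-Complex.I) (by simp)
  have h4 := hone Complex.I (by simp)
  rw [← mul_add]
  calc _ ≤ σ * (Real.exp (1 / 2) + Real.exp (1 / 2) + (Real.exp (1 / 2) + Real.exp (1 / 2))) := by
        gcongr
    _ = 4 * Real.exp (1 / 2) * σ := by ring

/-- If the norm is at least `δ`, then one of `±Re`, `±Im` is at least `δ/2`. A Chernoff bound in
each of these four directions and a union bound finish. -/
theorem measureReal_norm_ge_le_of_subgaussian [IsFiniteMeasure P] (hσ : 0 < σ)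
    (hint : ∀ (u : ℂ) (r : ℝ), Integrable (fun ω => Real.exp (r * (u * X ω).re)) P)
    (hmgf : ∀ u : ℂ, ‖u‖ = 1 → ∀ r : ℝ,
      ∫ ω, Real.exp (r * (u * X ω).re) ∂P ≤ Real.exp (r ^ 2 * σ ^ 2 / 2)) {δ : ℝ} (hδ : 0 ≤ δ) :
    P.real {ω | δ ≤ ‖X ω‖} ≤ 4 * Real.exp (-(δ ^ 2 / (8 * σ ^ 2))) := by
  have hone : ∀ u : ℂ, ‖u‖ = 1 →
      P.real {ω | δ / 2 ≤ (u * X ω).re} ≤ Real.exp (-(δ ^ 2 / (8 * σ ^ 2))) := by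
    intro u hu
    -- This is the minimizer of the Chernoff exponent `-rδ/2 + r²σ²/2`, with value `-δ²/(8σ²)`.
    have hr : 0 ≤ δ / (2 * σ ^ 2) := by positivity
    refine (ProbabilityTheory.measure_ge_le_exp_mul_mgf (δ / 2) hr (hint u _)).trans ?_
    refine (mul_le_mul_of_nonneg_left (hmgf u hu _) (Real.exp_nonneg _)).trans (le_of_eq ?_)
    rw [← Real.exp_add]
    congr 1
    field_simp
    ring
  have hsub : {ω | δ ≤ ‖X ω‖} ⊆
      ({ω | δ / 2 ≤ (1 * X ω).re} ∪ {ω | δ / 2 ≤ (-1 * X ω).re}) ∪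
      ({ω | δ / 2 ≤ (-Complex.I * X ω).re} ∪ {ω | δ / 2 ≤ (Complex.I * X ω).re}) := by
    intro ω hω
    by_contra h
    simp only [Set.mem_union, Set.mem_ofPred_eq, one_mul, neg_mul, Complex.neg_re,
      Complex.I_mul_re, neg_neg, not_or, not_le] at h hω
    obtain ⟨⟨h1, h2⟩, h3, h4⟩ := h
    have h5 : |(X ω).re| < δ / 2 := abs_lt.mpr ⟨by linarith, h1⟩
    have h6 : |(X ω).im| < δ / 2 := abs_lt.mpr ⟨by linarith, h3⟩
    have h7 := Complex.norm_le_abs_re_add_abs_im (X ω)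
    linarith
  refine (measureReal_mono hsub).trans ((measureReal_union_le _ _).trans
    ((add_le_add (measureReal_union_le _ _) (measureReal_union_le _ _)).trans ?_))
  have h1 := hone 1 (by simp)
  have h2 := hone (-1) (by simp)
  have h3 := hone (-Complex.I) (by simp)
  have h4 := hone Complex.I (by simp)
  linarith

end Subgaussian

end

end SpinChain

/-! ### Choice of constants -/

theorem theorem2 (d : ℕ) (hd : 1 ≤ d) (k : ℕ) (M : ℝ) :
    ∃ K C c : ℝ, 0 < K ∧ 0 < C ∧ 0 < c ∧ ∃ n₀ : ℕ, ∀ n : ℕ, n₀ ≤ n →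
      ∀ (H : SpinChain.Op d n) (hH : H.IsHermitian),
        SpinChain.IsTranslationInvariant H → SpinChain.HasNondegenerateSpectrum hH →
      ∀ A : SpinChain.Op d n,
        SpinChain.IsLocal k A → A.trace = 0 → SpinChain.opNorm A ≤ M →
        -- the limit that defines the time average exists in every product state
        (∀ ψ : Fin n → SpinChain.SpinState d,
          Tendsto (SpinChain.finiteTimeAverage H A ψ) atTop
            (𝓝 (SpinChain.timeAverage H A ψ))) ∧
        -- the mean of its absolute value
        Integrable (fun ψ => ‖SpinChain.timeAverage H A ψ‖) (SpinChain.randomProductState d n) ∧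
        ∫ ψ, ‖SpinChain.timeAverage H A ψ‖ ∂(SpinChain.randomProductState d n) ≤
          K / Real.sqrt n ∧
        -- the tail bound
        ∀ δ : ℝ, C * Real.sqrt (Real.log n / n) ≤ δ →
          (SpinChain.randomProductState d n).real {ψ | δ ≤ ‖SpinChain.timeAverage H A ψ‖} ≤
            Real.exp (-(c * (n * δ ^ 2))) := by
  -- The maximum makes the norm bound strictly positive, as Hoeffding's lemma requires.
  set M₁ : ℝ := max M 1
  have hM₁ : 0 < M₁ := lt_max_of_lt_right one_pos
  set q : ℝ := 2 * (k + 1) with hq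
  have hq0 : 0 < q := by positivity
  -- The variance proxy is `σ² = M₁²q/n`, where `q` satisfies `n ≤ q⌊n/(k+1)⌋`. The constant `c` is
  -- half the Chernoff rate `1/(8M₁²q)`; the other half absorbs the prefactor 4. For this, `C` is
  -- chosen so that `c n δ² ≥ 2 log n`, and the threshold on `n` ensures `n ≥ 2`, hence `exp(2 log
  -- n) = n² ≥ 4`.
  refine ⟨4 * Real.exp (1 / 2) * (M₁ * Real.sqrt q), Real.sqrt (32 * M₁ ^ 2 * q),
    1 / (16 * M₁ ^ 2 * q), by positivity, by positivity, by positivity, 2 * (k + 1), ?_⟩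
  intro n hn H hH hT hE A hloc htr hAM
  have hk : 0 < n / (k + 1) := Nat.div_pos (by omega) (Nat.succ_pos k)
  have hn2 : (2 : ℝ) ≤ n := by exact_mod_cast (by omega : 2 ≤ n)
  have hn0 : (0 : ℝ) < n := by linarith
  have hcount : (n : ℝ) ≤ q * (n / (k + 1) : ℕ) := by
    have h1 : n < (n / (k + 1) + 1) * (k + 1) := Nat.lt_mul_of_div_lt (Nat.lt_succ_self _)
      (Nat.succ_pos k)
    have h2 : n ≤ 2 * (k + 1) * (n / (k + 1)) := by nlinarith
    rw [hq]
    exact_mod_cast h2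
  have := SpinChain.isProbabilityMeasure_randomProductState hd n
  have hX := SpinChain.continuous_timeAverage hH hE A
  set σ : ℝ := M₁ * Real.sqrt (q / n) with hσdef
  have hσ : 0 < σ := by positivity
  have hσ2 : σ ^ 2 = M₁ ^ 2 * q / n := by
    rw [hσdef, mul_pow, Real.sq_sqrt (by positivity)]
    ring
  have hint : ∀ (u : ℂ) (r : ℝ), Integrable
      (fun ψ => Real.exp (r * (u * SpinChain.timeAverage H A ψ).re))
      (SpinChain.randomProductState d n) := fun u r =>
    SpinChain.integrable_randomProductState hd (by fun_prop)
  have hmgf : ∀ u : ℂ, ‖u‖ = 1 → ∀ r : ℝ,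
      ∫ ψ, Real.exp (r * (u * SpinChain.timeAverage H A ψ).re)
        ∂(SpinChain.randomProductState d n) ≤ Real.exp (r ^ 2 * σ ^ 2 / 2) := by
    intro u hu r
    refine (SpinChain.integral_exp_timeAverage_le hd hH hT hE hloc htr hM₁
      (hAM.trans (le_max_left _ _)) hk hu r).trans (Real.exp_le_exp.mpr ?_)
    have hm0 : (0 : ℝ) < (n / (k + 1) : ℕ) := by exact_mod_cast hk
    have h : M₁ ^ 2 / (n / (k + 1) : ℕ) ≤ σ ^ 2 := by
      rw [hσ2, div_le_div_iff₀ hm0 hn0, mul_assoc]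
      gcongr
    calc r ^ 2 * M₁ ^ 2 / (2 * (n / (k + 1) : ℕ))
        = r ^ 2 * (M₁ ^ 2 / (n / (k + 1) : ℕ)) / 2 := by ring
      _ ≤ r ^ 2 * σ ^ 2 / 2 := by gcongr
  have hnorm : Integrable (fun ψ => ‖SpinChain.timeAverage H A ψ‖)
      (SpinChain.randomProductState d n) := SpinChain.integrable_randomProductState hd hX.norm
  refine ⟨fun ψ => ?_, hnorm, ?_, ?_⟩
  · rw [SpinChain.timeAverage_eq hH hE]
    exact SpinChain.tendsto_finiteTimeAverage hH hE A ψ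
  · refine (SpinChain.integral_norm_le_of_subgaussian hnorm hσ hint hmgf).trans (le_of_eq ?_)
    rw [hσdef, Real.sqrt_div hq0.le]
    ring
  · intro δ hδ
    have hlog : 0 < Real.log n := Real.log_pos (by linarith)
    have hδ0 : 0 ≤ δ := le_trans (by positivity) hδ
    refine (SpinChain.measureReal_norm_ge_le_of_subgaussian hσ hint hmgf hδ0).trans ?_
    have hsq : 32 * M₁ ^ 2 * q * (Real.log n / n) ≤ δ ^ 2 := by
      rw [← Real.sqrt_mul (by positivity)] at hδ
      exact (Real.sqrt_le_left hδ0).mp hδ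
    have hlarge : 2 * Real.log n ≤ 1 / (16 * M₁ ^ 2 * q) * (n * δ ^ 2) := by
      calc 2 * Real.log n =
          1 / (16 * M₁ ^ 2 * q) * (n * (32 * M₁ ^ 2 * q * (Real.log n / n))) := by
            field_simp
            norm_num
        _ ≤ _ := by gcongr
    have hfour : (4 : ℝ) ≤ Real.exp (1 / (16 * M₁ ^ 2 * q) * (n * δ ^ 2)) := by
      refine le_trans ?_ (Real.exp_le_exp.mpr hlarge)
      rw [two_mul, Real.exp_add, Real.exp_log hn0]
      nlinarith
    calc 4 * Real.exp (-(δ ^ 2 / (8 * σ ^ 2)))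
        ≤ Real.exp (1 / (16 * M₁ ^ 2 * q) * (n * δ ^ 2)) *
          Real.exp (-(δ ^ 2 / (8 * σ ^ 2))) := by gcongr
      _ = Real.exp (-(1 / (16 * M₁ ^ 2 * q) * (n * δ ^ 2))) := by
          rw [← Real.exp_add, hσ2]
          congr 1
          field_simp
          ring
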